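/- Let $n\ge 1$ and let $x=(x_1,\dots,x_n)\in\mathbb Z^n$ with $x_1>x_2>\cdots>x_n$. A discrete Gelfand–Tsetlin pattern of depth $n$ is a tuple $(y^{(1)},\dots,y^{(n)})\in\mathbb Z\times\mathbb Z^2\times\cdots\times\mathbb Z^n$ such that $$y^{(r+1)}_1\ge y^{(r)}_1>y^{(r+1)}_2\ge y^{(r)}_2>\cdots\ge y^{(r)}_r>y^{(r+1)}_{r+1}\qquad(1\le r\le n-1).$$ It is regarded as a configuration of $N=\tfrac12 n(n+1)$ particles in $\Lambda=\mathbb Z\times\{1,\dots,n\}$, with particles at the positions $(y^{(r)}_i,r)$, $1\le i\le r\le n$. Let $\nu_n$ be the uniform probability measure on the patterns with top row $y^{(n)}=x$. (It is well defined: the set of such patterns is finite and non-empty.) For $m\le N$, the $m$-th correlation function $\rho_m$ of the resulting point process is the density, with respect to counting measure on $\Lambda^m$, of the measure $B\mapsto\mathbb E_{\nu_n}[\#\{m\text{-tuples of distinct particles lying in }B\}]$, $B\subset\Lambda^m$. The process is determinantal: there is a function $K_n:\Lambda^2\to\mathbb C$ such that $$\rho_m(z_1,\dots,z_m)=\det[K_n(z_i,z_j)]_{i,j=1}^m\qquad\text{for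 all } m\le N \text{ and } z_1,\dots,z_m\in\Lambda.$$ Moreover, $\nu_n$-almost surely every particle $(u,r)$ satisfies $u\ge x_n+n-r$, and $K_n$ can be chosen such that for all $r,s\in\{1,\dots,n-1\}$ and all integers $u\ge x_n+n-r$, $v\ge x_n+n-s$, $$K_n((u,r),(v,s))=\widetilde K_n((u,r),(v,s))-\phi_{r,s}(u,v),$$ where $$\widetilde K_n((u,r),(v,s))=\frac{(n-s)!}{(n-r-1)!}\sum_{k=1}^n 1_{(x_k\ge u)}\sum_{l=v+s-n}^{v}\frac{\prod_{j=u+r-n+1}^{u-1}(x_k-j)}{\prod_{j=v+s-n,\,j\ne l}^{v}(l-j)}\prod_{i=1,\,i\ne k}^n\frac{l-x_i}{x_k-x_i}$$ (empty products being $1$), and $$\phi_{r,s}(u,v)=1_{(v\ge u)}\cdot\begin{cases}0,& s\le r,\\ 1,& s=r+1,\\ \dfrac{1}{(s-r-1)!}\displaystyle\prod_{j=1}^{s-r-1}(v-u+s-r-j),& s>r+1.\end{cases}$$ -/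

import Mathlib

open MeasureTheory
open scoped NNReal ENNReal Nat

noncomputable section

/-! ### Determinantal point processes with finitely many labelled particles -/

/-- For a configuration `y` of particles labelled by `ι`, the number of `m`-tuples of particles
with pairwise distinct labels that lie in `B ⊆ Λ^m`. -/
def tupleCount {Λ ι : Type*} (m : ℕ) (B : Set (Fin m → Λ)) (y : ι → Λ) : ℕ :=
  Set.ncard {f : Fin m ↪ ι | (fun k => y (f k)) ∈ B}

/-- `ρ` is an `m`-th correlation function, with respect to the reference measure `lam`, of the
random configuration `X` under `P`: it is a density with respect to `lam^m` of the measure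
`B ↦ 𝔼[number of m-tuples of distinct particles in B]`. -/
structure IsCorrelationFunction {Ω Λ ι : Type*} [MeasurableSpace Ω] [MeasurableSpace Λ]
    [Fintype ι] (P : Measure Ω) (X : Ω → ι → Λ) (lam : Measure Λ) (m : ℕ)
    (ρ : (Fin m → Λ) → ℝ≥0) : Prop where
  measurable : Measurable ρ
  lintegral_eq : ∀ B : Set (Fin m → Λ), MeasurableSet B →
    ∫⁻ z in B, (ρ z : ℝ≥0∞) ∂(Measure.pi fun _ : Fin m => lam) =
      ∫⁻ ω, (tupleCount m B (X ω) : ℝ≥0∞) ∂P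

/-- `X` under `P` is a random point process with `Fintype.card ι` particles in `Λ` which is
determinantal, with correlation kernel `K` with respect to the reference measure `lam`. -/
structure IsDeterminantalProcess {Ω Λ ι : Type*} [MeasurableSpace Ω] [MeasurableSpace Λ]
    [Fintype ι] (P : Measure Ω) (X : Ω → ι → Λ) (lam : Measure Λ) (K : Λ → Λ → ℂ) : Prop where
  isProbabilityMeasure : IsProbabilityMeasure P
  measurable : Measurable X
  correlation : ∀ m : ℕ, m ≤ Fintype.card ι → ∃ ρ : (Fin m → Λ) → ℝ≥0,
    IsCorrelationFunction P X lam m ρ ∧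
      ∀ z : Fin m → Λ, ((ρ z : ℝ) : ℂ) = (Matrix.of fun i j : Fin m => K (z i) (z j)).det

/-! ### Discrete Gelfand–Tsetlin patterns -/

/-- `a₁ ≥ b₁ > a₂ ≥ b₂ > ⋯ ≥ b_r > a_{r+1}`. -/
def Interlaces {r : ℕ} (a : Fin (r + 1) → ℤ) (b : Fin r → ℤ) : Prop :=
  ∀ i : Fin r, b i ≤ a i.castSucc ∧ a i.succ < b i

/-- Discrete Gelfand–Tsetlin patterns `(y⁽¹⁾, …, y⁽ⁿ⁾) ∈ ℤ × ℤ² × ⋯ × ℤⁿ` of depth `n`. -/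
abbrev GTPattern (n : ℕ) : Type :=
  {y : (r : Set.Icc 1 n) → Fin r.1 → ℤ //
    ∀ (r : ℕ) (h₁ : 1 ≤ r) (h₂ : r + 1 ≤ n),
      Interlaces (y ⟨r + 1, Nat.le_add_left 1 r, h₂⟩) (y ⟨r, h₁, (Nat.le_succ r).trans h₂⟩)}

/-- The space `ℤ × {1, …, n}` of particle positions. -/
abbrev GTPosition (n : ℕ) : Type := ℤ × Set.Icc 1 n

/-- The labels `(r, i)`, `1 ≤ r ≤ n`, of the `n (n + 1) / 2` particles. -/
abbrev GTLabel (n : ℕ) : Type := (r : Set.Icc 1 n) × Fin r.1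

/-- The particle configuration of a pattern: particle `(r, i)` is at position `(y⁽ʳ⁾ᵢ, r)`. -/
def gtParticles {n : ℕ} (y : GTPattern n) : GTLabel n → GTPosition n :=
  fun p => (y.1 p.1 p.2, p.1)

/-- The uniform probability measure on the patterns of depth `n` with top row `x`. -/
def gtUniform {n : ℕ} (hn : 1 ≤ n) (x : Fin n → ℤ) : Measure (GTPattern n) :=
  ProbabilityTheory.uniformOn {y : GTPattern n | y.1 ⟨n, hn, le_rfl⟩ = x}

/-! ### The kernel -/

/-- The function `φ_{r,s}(u,v)`. -/
def gtPhi (r s : ℕ) (u v : ℤ) : ℂ :=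
  if u ≤ v then
    if s ≤ r then 0
    else if s = r + 1 then 1
    else (1 / ((s - r - 1)! : ℂ)) *
      ∏ j ∈ Finset.Icc 1 (s - r - 1), ((v : ℂ) - u + s - r - j)
  else 0

/-- The function `K̃ₙ((u,r),(v,s))`, for `1 ≤ r, s ≤ n - 1`. -/
def gtKernelTilde {n : ℕ} (x : Fin n → ℤ) (u : ℤ) (r : ℕ) (v : ℤ) (s : ℕ) : ℂ :=
  ((n - s)! : ℂ) / ((n - r - 1)! : ℂ) *
    ∑ k : Fin n, (if u ≤ x k then (1 : ℂ) else 0) *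
      ∑ l ∈ Finset.Icc (v + s - n) v,
        (∏ j ∈ Finset.Icc (u + r - n + 1) (u - 1), ((x k : ℂ) - j)) /
            (∏ j ∈ (Finset.Icc (v + s - n) v).erase l, ((l : ℂ) - j)) *
          ∏ i ∈ Finset.univ.erase k, (((l : ℂ) - x i) / ((x k : ℂ) - x i))

end

noncomputable section

/-! ### Binomial sums over integer intervals -/

/-! Give every site (u, r) a weight h(r, u), and sum over all patterns with top row x the product of
the weights of the particles. Summing out one row at a time turns this into ∏ h(n, x_j) times the
determinant of the functions `rowFn` at the x_j, which arise from constants by iterated weighted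
summation (`det_rowFn_succ`, `sum_patternArrays_prod`).

Now let h be 1 - t_a at finitely many distinct marked sites a, and 1 elsewhere. The row functions
satisfy a Duhamel-type equation around h = 1 whose propagator is φ (`rowFn_perturb`). At h = 1 they
are binomial polynomials of degree less than n, so their value at any lower admissible site is a
linear combination of their values at the x_k: interpolate at the nodes x_k, then take n - s
differences (`sum_rowFnOne_mul_nodeFn`). This replaces the inverse of the unperturbed matrix. A
block determinant combines both facts into: weighted count = Z · det(1 - tK), with K = Σ_k `topFn` ·
`nodeFn` - φ (`weighted_count_eq_det`); below the top row the sum is K̃.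

Evaluating at t ∈ {0,1}^m and applying inclusion–exclusion to both sides gives P(all marked sites
are occupied) = det K (`sum_prod_occupied_eq_det`). On a countable space with counting measure these
probabilities are the correlation functions. -/

lemma sum_range_choose_add {d k : ℕ} (hd : d ≤ k) (N : ℕ) :
    ∑ j ∈ Finset.range N, (j + d).choose k = (N + d).choose (k + 1) := by
  induction N with
  | zero => simp [Nat.choose_eq_zero_of_lt (Nat.lt_succ_of_le hd)]
  | succ N ih =>
    rw [Finset.sum_range_succ, ih, add_right_comm N 1 d, Nat.choose_succ_succ, add_comm]

lemma sum_Icc_int_eq_sum_range {M : Type*} [AddCommMonoid M] (a b : ℤ) (f : ℤ → M) :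
    ∑ u ∈ Finset.Icc a b, f u = ∑ j ∈ Finset.range (b + 1 - a).toNat, f (a + j) := by
  refine Finset.sum_nbij' (fun u => (u - a).toNat) (fun j => a + j) ?_ ?_ ?_ ?_ ?_
  · intro u hu; simp only [Finset.mem_Icc, Finset.mem_range] at *; omega
  · intro j hj; simp only [Finset.mem_Icc, Finset.mem_range] at *; omega
  · intro u hu; simp only [Finset.mem_Icc] at *; omega
  · intro j hj; simp
  · intro u hu
    simp only [Finset.mem_Icc] at *
    congr 1; omega

lemma sum_Icc_choose_add {d k : ℕ} (hd : d ≤ k) (a b : ℤ) :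
    ∑ u ∈ Finset.Icc a b, (((u - a).toNat + d).choose k : ℂ)
      = (((b + 1 - a).toNat + d).choose (k + 1) : ℂ) := by
  rw [sum_Icc_int_eq_sum_range, ← sum_range_choose_add hd]
  simp

/-! ### The transition functions -/

lemma prod_Icc_add_sub (d k : ℕ) :
    ∏ j ∈ Finset.Icc 1 k, ((d : ℂ) + k + 1 - j) = (k ! : ℂ) * ((d + k).choose k : ℂ) := by
  rw [← Nat.cast_mul, ← Nat.descFactorial_eq_factorial_mul_choose, Nat.descFactorial_eq_prod_range,
    Nat.cast_prod, Finset.range_eq_Ico, ← Finset.Ico_add_one_right_eq_Icc,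
    ← Finset.prod_Ico_add' (fun j : ℕ => (d : ℂ) + k + 1 - j) 0 k 1]
  refine Finset.prod_congr rfl fun j hj => ?_
  rw [Finset.mem_Ico] at hj
  rw [Nat.cast_sub (by omega)]
  push_cast
  ring

lemma gtPhi_eq_choose (r s : ℕ) (u v : ℤ) :
    gtPhi r s u v =
      if u ≤ v ∧ r < s then (((v - u).toNat + (s - r - 1)).choose (s - r - 1) : ℂ) else 0 := by
  unfold gtPhi
  by_cases huv : u ≤ v
  · by_cases hrs : r < s
    · rw [if_pos huv, if_neg (by omega), if_pos (⟨huv, hrs⟩ : u ≤ v ∧ r < s)]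
      split_ifs with h
      · simp [h]
      · have key := prod_Icc_add_sub (v - u).toNat (s - r - 1)
        have h1 : (((v - u).toNat : ℕ) : ℂ) = (v : ℂ) - u := by
          rw [← Int.cast_sub, ← Int.cast_natCast, Int.toNat_of_nonneg (by omega)]
        have h2 : ((s - r - 1 : ℕ) : ℂ) = (s : ℂ) - r - 1 := by
          rw [Nat.cast_sub (by omega), Nat.cast_sub (by omega)]; simp
        have h3 : ((s - r - 1)! : ℂ) ≠ 0 := by exact_mod_cast Nat.factorial_ne_zero _
        rw [show (∏ j ∈ Finset.Icc 1 (s - r - 1), ((v : ℂ) - u + s - r - j))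
          = ∏ j ∈ Finset.Icc 1 (s - r - 1),
            ((((v - u).toNat : ℕ) : ℂ) + ((s - r - 1 : ℕ) : ℂ) + 1 - j) from ?_, key]
        · field_simp
        · refine Finset.prod_congr rfl fun j _ => ?_
          rw [h1, h2]; ring
    · rw [if_pos huv, if_pos (by omega), if_neg (by omega)]
  · rw [if_neg huv, if_neg (by omega)]

lemma gtPhi_eq_zero_of_le {r s : ℕ} (h : s ≤ r) (u v : ℤ) : gtPhi r s u v = 0 := by
  rw [gtPhi_eq_choose, if_neg (by omega)]

/-- The transition functions form a semigroup under convolution. -/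
lemma sum_gtPhi_add_eq_gtPhi_succ (r s : ℕ) {a u : ℤ} (ha : a ≤ u) (v : ℤ) :
    ∑ w ∈ Finset.Icc a v, gtPhi r s u w + (if r = s ∧ u ≤ v then 1 else 0)
      = gtPhi r (s + 1) u v := by
  simp only [gtPhi_eq_choose]
  rcases lt_trichotomy r s with h | h | h
  · rw [if_neg (by omega), add_zero]
    by_cases huv : u ≤ v
    · rw [if_pos (by omega)]
      rw [← Finset.sum_subset (s₁ := Finset.Icc u v)]
      · have : s + 1 - r - 1 = s - r - 1 + 1 := by omega
        rw [this, show (v - u).toNat + (s - r - 1 + 1) = (v + 1 - u).toNat + (s - r - 1) by omega,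
          ← sum_Icc_choose_add le_rfl]
        refine Finset.sum_congr rfl fun w hw => ?_
        rw [Finset.mem_Icc] at hw
        rw [if_pos ⟨hw.1, h⟩]
      · exact Finset.Icc_subset_Icc_left ha
      · intro w hw hw'
        rw [Finset.mem_Icc] at hw hw'
        rw [if_neg (by omega)]
    · rw [if_neg (by omega)]
      refine Finset.sum_eq_zero fun w hw => ?_
      rw [Finset.mem_Icc] at hw
      rw [if_neg (by omega)]
  · subst h
    simp
  · rw [if_neg (by omega), if_neg (by omega)]
    simp only [add_zero]
    refine Finset.sum_eq_zero fun w _ => ?_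
    rw [if_neg (by omega)]

/-! ### Weighted row functions -/

/-- The `i`-th function in the determinantal formula for the weighted number of patterns: it is
born as the constant `1` at level `i + 1`, and at each later level it is the weighted partial sum
of the previous level, starting from the smallest admissible position `C - s`. -/
def rowFn (C : ℤ) (h : ℕ → ℤ → ℂ) (i : ℕ) : ℕ → ℤ → ℂ
  | 0, _ => 0
  | s + 1, v => (if i = s then 1 else 0) + ∑ u ∈ Finset.Icc (C - s) v, h s u * rowFn C h i s u

lemma rowFn_succ (C : ℤ) (h : ℕ → ℤ → ℂ) (i s : ℕ) (v : ℤ) :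
    rowFn C h i (s + 1) v
      = (if i = s then 1 else 0) + ∑ u ∈ Finset.Icc (C - s) v, h s u * rowFn C h i s u := rfl

lemma rowFn_eq_zero (C : ℤ) (h : ℕ → ℤ → ℂ) {i s : ℕ} (hs : s ≤ i) (v : ℤ) :
    rowFn C h i s v = 0 := by
  induction s generalizing v with
  | zero => rfl
  | succ s ih =>
    rw [rowFn_succ, if_neg (by omega), zero_add]
    exact Finset.sum_eq_zero fun u _ => by rw [ih (by omega), mul_zero]

/-- The unweighted row functions. -/
abbrev rowFnOne (C : ℤ) : ℕ → ℕ → ℤ → ℂ := rowFn C fun _ _ => 1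

/-- Each level sums from a lower end that moves down by one, so the hockey-stick identity applies
with no boundary terms. -/
lemma rowFnOne_eq_choose (C : ℤ) (i s : ℕ) {v : ℤ} (hv : C - s ≤ v) :
    rowFnOne C i s v = if i < s then ((v - (C - s)).toNat.choose (s - 1 - i) : ℂ) else 0 := by
  split_ifs with h
  · induction s generalizing v with
    | zero => omega
    | succ s ih =>
      rw [rowFnOne, rowFn_succ]
      rcases Nat.lt_succ_iff_lt_or_eq.1 h with h' | h'
      · rw [if_neg (by omega), zero_add]
        have := sum_Icc_choose_add (Nat.zero_le (s - 1 - i)) (C - s) v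
        simp only [add_zero] at this
        rw [show s + 1 - 1 - i = s - 1 - i + 1 by omega,
          show v - (C - ((s + 1 : ℕ) : ℤ)) = v + 1 - (C - s) by push_cast; ring, ← this]
        refine Finset.sum_congr rfl fun u hu => ?_
        rw [Finset.mem_Icc] at hu
        rw [one_mul]
        exact ih hu.1 h'
      · subst h'
        rw [Finset.sum_eq_zero fun u _ => by rw [rowFn_eq_zero _ _ le_rfl, mul_zero]]
        simp
  · exact rowFn_eq_zero _ _ (by omega) v

/-- Changing the weights at finitely many positions. -/
lemma rowFn_perturb {ι : Type*} [Fintype ι] (C : ℤ) (t : ι → ℂ) (lev : ι → ℕ) (pos : ι → ℤ)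
    (hpos : ∀ a, C - lev a ≤ pos a) (i s : ℕ) (v : ℤ) :
    let h : ℕ → ℤ → ℂ := fun r u => 1 - ∑ a, if lev a = r ∧ pos a = u then t a else 0
    rowFn C h i s v = rowFnOne C i s v
      - ∑ a, rowFn C h i (lev a) (pos a) * t a * gtPhi (lev a) s (pos a) v := by
  intro h
  induction s generalizing v with
  | zero =>
    simp only [rowFn, zero_sub]
    rw [Finset.sum_eq_zero fun a _ => by rw [gtPhi_eq_zero_of_le (Nat.zero_le _), mul_zero]]
    simp
  | succ s ih =>
    rw [rowFnOne, rowFn_succ, rowFn_succ]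
    -- Only marked positions on level s produce a correction, and `hpos` places them above the lower
    -- summation limit.
    have h1 : ∑ u ∈ Finset.Icc (C - s) v, h s u * rowFn C h i s u
        = ∑ u ∈ Finset.Icc (C - s) v, rowFn C h i s u
          - ∑ a, rowFn C h i (lev a) (pos a) * t a * (if lev a = s ∧ pos a ≤ v then 1 else 0) := by
      simp only [h, sub_mul, Finset.sum_sub_distrib, one_mul, Finset.sum_mul]
      congr 1
      rw [Finset.sum_comm]
      refine Finset.sum_congr rfl fun a _ => ?_
      by_cases ha : lev a = s
      · simp only [ha, true_and, ite_mul, zero_mul]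
        rw [Finset.sum_ite_eq]
        have := hpos a
        by_cases hv : pos a ≤ v
        · rw [if_pos (Finset.mem_Icc.2 ⟨by omega, hv⟩), if_pos hv]; ring
        · rw [if_neg (by simp [hv]), if_neg hv, mul_zero]
      · simp [ha]
    rw [h1, Finset.sum_congr rfl fun u _ => ih u, Finset.sum_sub_distrib, Finset.sum_comm]
    simp only [one_mul, ← Finset.mul_sum]
    rw [add_sub_assoc, sub_sub, ← Finset.sum_add_distrib]
    congr 2
    -- Corrections from below level s propagate by the semigroup law; those born on level s enter
    -- through its indicator, as φ_{s,s} = 0.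
    refine Finset.sum_congr rfl fun a _ => ?_
    rw [← mul_add]
    by_cases hs : lev a ≤ s
    · rw [sum_gtPhi_add_eq_gtPhi_succ]
      have := hpos a
      omega
    · rw [gtPhi_eq_zero_of_le (by omega), if_neg (by omega),
        Finset.sum_eq_zero fun u _ => gtPhi_eq_zero_of_le (by omega) _ _]
      simp

/-! ### Finite differences and Lagrange interpolation -/

lemma prod_erase_range_sub {m t : ℕ} (ht : t ≤ m) :
    ∏ j ∈ (Finset.range (m + 1)).erase t, ((t : ℂ) - j) = (-1) ^ (m - t) * (t ! * (m - t)! : ℂ) := by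
  have hsplit : (Finset.range (m + 1)).erase t = Finset.range t ∪ Finset.Ico (t + 1) (m + 1) := by
    ext j; simp only [Finset.mem_erase, Finset.mem_range, Finset.mem_union, Finset.mem_Ico]; omega
  have hdisj : Disjoint (Finset.range t) (Finset.Ico (t + 1) (m + 1)) := by
    rw [Finset.disjoint_left]; intro j; simp only [Finset.mem_range, Finset.mem_Ico]; omega
  have h1 : ∏ j ∈ Finset.range t, ((t : ℂ) - j) = (t ! : ℂ) := by
    rw [← Nat.descFactorial_self, Nat.descFactorial_eq_prod_range, Nat.cast_prod]
    refine Finset.prod_congr rfl fun j hj => ?_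
    rw [Nat.cast_sub (Finset.mem_range.1 hj).le]
  have h2 : ∏ j ∈ Finset.Ico (t + 1) (m + 1), ((t : ℂ) - j) = (-1) ^ (m - t) * ((m - t)! : ℂ) := by
    rw [Finset.prod_Ico_eq_prod_range, ← Finset.prod_range_add_one_eq_factorial, Nat.cast_prod,
      show m + 1 - (t + 1) = m - t by omega]
    have : ((-1 : ℂ)) ^ (m - t) = ∏ _j ∈ Finset.range (m - t), (-1 : ℂ) := by simp
    rw [this, ← Finset.prod_mul_distrib]
    refine Finset.prod_congr rfl fun j _ => ?_
    push_cast; ring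
  rw [hsplit, Finset.prod_union hdisj, h1, h2]
  ring

lemma prod_Icc_erase_sub (w : ℤ) {m t : ℕ} (ht : t ≤ m) :
    ∏ j ∈ (Finset.Icc w (w + m)).erase (w + t), (((w + t : ℤ) : ℂ) - j)
      = (-1) ^ (m - t) * (t ! * (m - t)! : ℂ) := by
  rw [← prod_erase_range_sub ht]
  symm
  refine Finset.prod_nbij' (fun j => w + j) (fun u => (u - w).toNat) ?_ ?_ ?_ ?_ ?_
  · intro j hj; simp only [Finset.mem_erase, Finset.mem_Icc, Finset.mem_range] at *; omega
  · intro u hu; simp only [Finset.mem_erase, Finset.mem_Icc, Finset.mem_range] at *; omega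
  · intro j hj; simp
  · intro u hu; simp only [Finset.mem_erase, Finset.mem_Icc] at *; omega
  · intro j hj; push_cast; ring

/-- A divided difference at consecutive integers is an iterated forward difference. -/
lemma factorial_mul_sum_div_prod_eq_fwdDiff_iter (m : ℕ) (w : ℤ) (f : ℤ → ℂ) :
    (m ! : ℂ) * ∑ l ∈ Finset.Icc w (w + m),
        f l / ∏ j ∈ (Finset.Icc w (w + m)).erase l, ((l : ℂ) - j)
      = (fwdDiff 1)^[m] f w := by
  rw [fwdDiff_iter_eq_sum_shift, sum_Icc_int_eq_sum_range, Finset.mul_sum,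
    show (w + m + 1 - w).toNat = m + 1 by omega]
  refine Finset.sum_congr rfl fun t ht => ?_
  have ht' : t ≤ m := by rw [Finset.mem_range] at ht; omega
  rw [prod_Icc_erase_sub w ht', nsmul_one, zsmul_eq_mul]
  push_cast
  rw [Nat.cast_choose ℂ ht']
  have h1 : (t ! : ℂ) ≠ 0 := by exact_mod_cast Nat.factorial_ne_zero _
  have h2 : ((m - t)! : ℂ) ≠ 0 := by exact_mod_cast Nat.factorial_ne_zero _
  have h3 : ((-1 : ℂ) ^ (m - t)) * (-1) ^ (m - t) = 1 := by rw [← mul_pow]; simp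
  have h4 : ((-1 : ℂ) ^ (m - t)) ≠ 0 := left_ne_zero_of_mul_eq_one h3
  field_simp
  linear_combination (-(m ! : ℂ) * f (w + t)) * h3

lemma fwdDiff_iter_choose_eq_ite (m k N : ℕ) :
    (fwdDiff 1)^[m] (fun y : ℕ => (y.choose k : ℤ)) N
      = if m ≤ k then (N.choose (k - m) : ℤ) else 0 := by
  split_ifs with h
  · obtain ⟨j, rfl⟩ := Nat.exists_eq_add_of_le h
    rw [fwdDiff_iter_choose, Nat.add_sub_cancel_left]
  · obtain ⟨j, rfl⟩ := Nat.exists_eq_add_of_lt (not_le.1 h)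
    rw [show k + j + 1 = j + 1 + (k + 0) by omega, Function.iterate_add_apply, add_zero,
      show (fun y : ℕ => (y.choose k : ℤ)) = fun y => ((y.choose (k + 0) : ℕ) : ℤ) from rfl,
      fwdDiff_iter_choose]
    simp only [Nat.choose_zero_right, Nat.cast_one, Function.iterate_succ_apply, fwdDiff_const]
    simp [fwdDiff_iter_eq_sum_shift]

lemma factorial_mul_sum_choose_div_prod (m k : ℕ) {a w : ℤ} (h : a ≤ w) :
    (m ! : ℂ) * ∑ l ∈ Finset.Icc w (w + m),
        ((l - a).toNat.choose k : ℂ) / ∏ j ∈ (Finset.Icc w (w + m)).erase l, ((l : ℂ) - j)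
      = if m ≤ k then ((w - a).toNat.choose (k - m) : ℂ) else 0 := by
  rw [factorial_mul_sum_div_prod_eq_fwdDiff_iter m w fun l => ((l - a).toNat.choose k : ℂ)]
  have := fwdDiff_iter_choose_eq_ite m k (w - a).toNat
  -- Differences over ℕ and over ℤ are matched through their shift sums; a ≤ w keeps every `toNat`
  -- exact.
  rw [fwdDiff_iter_eq_sum_shift] at this ⊢
  apply_fun (Int.cast : ℤ → ℂ) at this
  push_cast at this
  rw [← this]
  refine Finset.sum_congr rfl fun t _ => ?_
  rw [show (w + t • (1 : ℤ) - a).toNat = (w - a).toNat + t • 1 by simp; omega]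
  simp

/-- Lagrange interpolation of a binomial coefficient. -/
lemma sum_choose_mul_prod_div {n k : ℕ} (hk : k < n) {x : Fin n → ℤ} (hx : Function.Injective x)
    {a : ℤ} (ha : ∀ j, a ≤ x j) {l : ℤ} (hl : a ≤ l) :
    ∑ j, ((x j - a).toNat.choose k : ℂ) *
        ∏ i ∈ Finset.univ.erase j, (((l : ℂ) - x i) / ((x j : ℂ) - x i))
      = ((l - a).toNat.choose k : ℂ) := by
  set p : Polynomial ℂ :=
    Polynomial.C ((k ! : ℂ)⁻¹) * (descPochhammer ℂ k).comp (Polynomial.X - Polynomial.C (a : ℂ))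
  have heval : ∀ y : ℤ, a ≤ y → p.eval (y : ℂ) = ((y - a).toNat.choose k : ℂ) := by
    intro y hy
    have hya : (y : ℂ) - a = ((y - a).toNat : ℂ) := by
      rw [← Int.cast_sub, ← Int.cast_natCast, Int.toNat_of_nonneg (by omega)]
    have h1 : (k ! : ℂ) ≠ 0 := by exact_mod_cast Nat.factorial_ne_zero _
    simp only [p, Polynomial.eval_mul, Polynomial.eval_C, Polynomial.eval_comp,
      Polynomial.eval_sub, Polynomial.eval_X]
    rw [hya, descPochhammer_eval_eq_descFactorial, Nat.descFactorial_eq_factorial_mul_choose,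
      Nat.cast_mul, inv_mul_cancel_left₀ h1]
  have hdeg : p.degree < (Finset.univ : Finset (Fin n)).card := by
    rw [Finset.card_univ, Fintype.card_fin]
    refine (Polynomial.degree_le_natDegree).trans_lt (Nat.cast_lt.2 (lt_of_le_of_lt ?_ hk))
    refine (Polynomial.natDegree_C_mul_le _ _).trans ?_
    rw [Polynomial.natDegree_comp, Polynomial.natDegree_X_sub_C, descPochhammer_natDegree, mul_one]
  have hinj : Set.InjOn (fun j => (x j : ℂ)) (Finset.univ : Finset (Fin n)) :=
    fun i _ j _ h => hx (Int.cast_injective h)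
  have key := congrArg (Polynomial.eval (l : ℂ)) (Lagrange.eq_interpolate hinj hdeg)
  rw [heval l hl, Lagrange.interpolate_apply, Polynomial.eval_finsetSum] at key
  rw [key]
  refine Finset.sum_congr rfl fun j _ => ?_
  rw [Polynomial.eval_mul, Polynomial.eval_C, heval _ (ha j), Lagrange.basis, Polynomial.eval_prod]
  congr 1
  refine Finset.prod_congr rfl fun i _ => ?_
  simp [Lagrange.basisDivisor, div_eq_inv_mul]

/-- The iterated difference at `v` of the Lagrange basis polynomial of the node `x k`. -/
def nodeFn {n : ℕ} (x : Fin n → ℤ) (k : Fin n) (v : ℤ) (s : ℕ) : ℂ :=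
  ((n - s)! : ℂ) * ∑ l ∈ Finset.Icc (v + s - n) v,
    (∏ i ∈ Finset.univ.erase k, (((l : ℂ) - x i) / ((x k : ℂ) - x i))) /
      ∏ j ∈ (Finset.Icc (v + s - n) v).erase l, ((l : ℂ) - j)

/-- On level n the row function is a polynomial of degree n - 1 - i < n, so interpolation at the
nodes recovers it exactly, and n - s differences undo the n - s summations separating level s from
level n. -/
lemma sum_rowFnOne_mul_nodeFn {n : ℕ} {x : Fin n → ℤ} (hx : Function.Injective x) {C : ℤ}
    (hC : ∀ j, C - n ≤ x j) {i s : ℕ} (hi : i < n) (hs : s ≤ n) {v : ℤ} (hv : C - s ≤ v) :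
    ∑ k, rowFnOne C i n (x k) * nodeFn x k v s = rowFnOne C i s v := by
  have h1 : ∀ k, rowFnOne C i n (x k) = ((x k - (C - n)).toNat.choose (n - 1 - i) : ℂ) := fun k => by
    rw [rowFnOne_eq_choose _ _ _ (hC k), if_pos hi]
  obtain ⟨m, rfl⟩ := Nat.exists_eq_add_of_le hs
  have hw : v = v + s - (s + m : ℕ) + m := by push_cast; ring
  have key := factorial_mul_sum_choose_div_prod m (s + m - 1 - i) (a := C - (s + m : ℕ))
    (w := v + s - (s + m : ℕ)) (by omega)
  rw [← hw] at key
  rw [rowFnOne_eq_choose _ _ _ hv]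
  simp only [h1, nodeFn, Nat.add_sub_cancel_left]
  -- For i ≥ s the degree n - 1 - i is below the number m of differences, so both sides vanish; m =
  -- 0 is excluded there by i < n.
  have h2 : (if i < s then ((v - (C - s)).toNat.choose (s - 1 - i) : ℂ) else 0)
      = if m ≤ s + m - 1 - i then ((v + s - (s + m : ℕ) - (C - (s + m : ℕ))).toNat.choose
          (s + m - 1 - i - m) : ℂ) else 0 := by
    rcases lt_or_ge i s with h | h
    · rw [if_pos h, if_pos (by omega)]
      congr 2 <;> omega
    · rw [if_neg (by omega)]
      rcases Nat.eq_zero_or_pos m with hm | hm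
      · omega
      · rw [if_neg (by omega)]
  rw [h2, ← key]
  simp only [mul_left_comm _ (m ! : ℂ)]
  rw [← Finset.mul_sum]
  congr 1
  simp only [Finset.mul_sum]
  rw [Finset.sum_comm]
  refine Finset.sum_congr rfl fun l hl => ?_
  rw [Finset.mem_Icc] at hl
  rw [← sum_choose_mul_prod_div (show s + m - 1 - i < s + m by omega) hx hC
    (l := l) (by omega), Finset.sum_div]
  exact Finset.sum_congr rfl fun k _ => by rw [mul_div_assoc]

/-- The transition from a particle position to the `k`-th particle of the top row. -/
def topFn {n : ℕ} (x : Fin n → ℤ) (u : ℤ) (r : ℕ) (k : Fin n) : ℂ :=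
  if r = n then if u = x k then 1 else 0 else gtPhi r n u (x k)

lemma sum_topFn_mul_nodeFn_eq_gtKernelTilde {n : ℕ} (x : Fin n → ℤ) (u v : ℤ) {r : ℕ} (s : ℕ)
    (hr : r < n) : ∑ k, topFn x u r k * nodeFn x k v s = gtKernelTilde x u r v s := by
  rw [gtKernelTilde, Finset.mul_sum]
  refine Finset.sum_congr rfl fun k _ => ?_
  rw [topFn, if_neg hr.ne]
  have hprod : gtPhi r n u (x k) = (if u ≤ x k then 1 else 0) * (((n - r - 1)! : ℂ)⁻¹ *
      ∏ j ∈ Finset.Icc (u + r - n + 1) (u - 1), ((x k : ℂ) - j)) := by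
    have h3 : ((n - r - 1)! : ℂ) ≠ 0 := by exact_mod_cast Nat.factorial_ne_zero _
    rw [gtPhi_eq_choose]
    by_cases hu : u ≤ x k
    · rw [if_pos ⟨hu, hr⟩, if_pos hu, one_mul, eq_inv_mul_iff_mul_eq₀ h3, ← prod_Icc_add_sub]
      have h1 : (((x k - u).toNat : ℕ) : ℂ) = (x k : ℂ) - u := by
        rw [← Int.cast_sub, ← Int.cast_natCast, Int.toNat_of_nonneg (by omega)]
      have h2 : ((n - r - 1 : ℕ) : ℂ) = (n : ℂ) - r - 1 := by
        rw [Nat.cast_sub (by omega), Nat.cast_sub (by omega)]; simp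
      -- The n - r - 1 factors of φ_{r,n}(u, x_k) have their roots at u + r - n + 1, …, u - 1.
      refine Finset.prod_nbij' (fun j => u + r - n + j) (fun l => (l - (u + r - n)).toNat)
        ?_ ?_ ?_ ?_ ?_
      · intro j hj; simp only [Finset.mem_Icc] at *; omega
      · intro j hj; simp only [Finset.mem_Icc] at *; omega
      · intro j hj; simp only [Finset.mem_Icc] at *; omega
      · intro j hj; simp only [Finset.mem_Icc] at *; omega
      · intro j hj; rw [h1, h2]; push_cast; ring
    · rw [if_neg (by omega), if_neg hu, zero_mul]
  rw [hprod, nodeFn]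
  simp only [Finset.mul_sum]
  refine Finset.sum_congr rfl fun l _ => ?_
  ring

/-! ### The weighted number of patterns as a determinant -/

lemma Matrix.det_sum_rows {ι κ R : Type*} [Fintype ι] [DecidableEq ι] [DecidableEq κ] [CommRing R]
    (A : ι → Finset κ) (g : ι → κ → ι → R) :
    (Matrix.of fun j => ∑ u ∈ A j, g j u).det
      = ∑ b ∈ Fintype.piFinset A, (Matrix.of fun j => g j (b j)).det :=
  (Matrix.detRowAlternating (R := R) (n := ι)).toMultilinearMap.map_sum_finset g A

/-- The rows interlacing with a given row `a` of the next level. -/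
def interlacingRows {r : ℕ} (a : Fin (r + 1) → ℤ) : Finset (Fin r → ℤ) :=
  Fintype.piFinset fun i => Finset.Ioc (a i.succ) (a i.castSucc)

lemma mem_interlacingRows {r : ℕ} {a : Fin (r + 1) → ℤ} {b : Fin r → ℤ} :
    b ∈ interlacingRows a ↔ Interlaces a b := by
  simp [interlacingRows, Interlaces, and_comm]

lemma Interlaces.strictAnti {r : ℕ} {a : Fin (r + 1) → ℤ} {b : Fin r → ℤ} (h : Interlaces a b)
    (ha : Antitone a) : StrictAnti b := fun i j hij =>
  ((h j).1.trans (ha (by rw [Fin.le_def, Fin.val_succ, Fin.val_castSucc]; omega))).trans_lt (h i).2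

lemma Interlaces.le {r : ℕ} {a : Fin (r + 1) → ℤ} {b : Fin r → ℤ} (h : Interlaces a b)
    {c : ℤ} (ha : ∀ j, c ≤ a j) (j : Fin r) : c + 1 ≤ b j :=
  (Int.add_le_add_right (ha j.succ) 1).trans (h j).2

/-- The last row is constantly 1, being the function just born. Subtracting from each column its
predecessor reduces that row to its first entry, and the remaining minor has entries that are, up to
sign, sums over the intervals available to the b_j. Interlacing is a product condition, so
multilinearity pulls the sums out. -/
lemma det_rowFn_succ (C : ℤ) (h : ℕ → ℤ → ℂ) (r : ℕ) {a : Fin (r + 1) → ℤ} (ha : Antitone a)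
    (hC : ∀ j, C - (r + 1 : ℕ) ≤ a j) :
    (Matrix.of fun i j : Fin (r + 1) => rowFn C h i (r + 1) (a j)).det
      = ∑ b ∈ interlacingRows a,
        (∏ j, h r (b j)) * (Matrix.of fun i j : Fin r => rowFn C h i r (b j)).det := by
  set A : Matrix (Fin (r + 1)) (Fin (r + 1)) ℂ := Matrix.of fun i j => rowFn C h i (r + 1) (a j)
  set B : Matrix (Fin (r + 1)) (Fin (r + 1)) ℂ :=
    Matrix.of fun i j => Fin.cases (A i 0) (fun k => A i k.succ - A i k.castSucc) j
  have hAB : A.det = B.det :=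
    Matrix.det_eq_of_forall_col_eq_smul_add_pred (fun _ => 1) (fun i => by simp [B])
      (fun i j => by simp [B])
  have hlast : ∀ j, A (Fin.last r) j = 1 := fun j => by
    simp only [A, Matrix.of_apply, Fin.val_last, rowFn_succ, if_true]
    rw [Finset.sum_eq_zero fun u _ => by rw [rowFn_eq_zero _ _ le_rfl, mul_zero], add_zero]
  have hdiff : ∀ i j : Fin r, -B i.castSucc j.succ
      = ∑ u ∈ Finset.Ioc (a j.succ) (a j.castSucc), h r u * rowFn C h i r u := by
    intro i j
    have hle : a j.succ ≤ a j.castSucc := ha (Fin.castSucc_le_succ j)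
    have hlow := hC j.succ
    have hsplit : Finset.Icc (C - r) (a j.castSucc)
        = Finset.Icc (C - r) (a j.succ) ∪ Finset.Ioc (a j.succ) (a j.castSucc) := by
      ext u
      simp only [Finset.mem_union, Finset.mem_Icc, Finset.mem_Ioc]
      push_cast at hlow
      omega
    have hdisj : Disjoint (Finset.Icc (C - r) (a j.succ))
        (Finset.Ioc (a j.succ) (a j.castSucc)) := by
      rw [Finset.disjoint_left]
      intro u
      simp only [Finset.mem_Icc, Finset.mem_Ioc]
      omega
    simp only [A, B, Matrix.of_apply, Fin.cases_succ, rowFn_succ, hsplit,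
      Finset.sum_union hdisj]
    simp
  rw [hAB, Matrix.det_succ_row B (Fin.last r), Fin.sum_univ_succ, Finset.sum_eq_zero, add_zero]
  · have hB0 : B (Fin.last r) 0 = 1 := by simp [B, hlast]
    rw [hB0, Fin.val_last, Fin.val_zero, add_zero, mul_one]
    -- The cofactor sign cancels the r signs of the column differences in `hdiff`.
    have : ((-1 : ℂ)) ^ r
        * (B.submatrix (Fin.last r).succAbove (Fin.succAbove 0)).det
        = (Matrix.of fun j => ∑ u ∈ Finset.Ioc (a j.succ) (a j.castSucc),
            fun i : Fin r => h r u * rowFn C h i r u).det := by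
      have h1 := Matrix.det_neg (B.submatrix (Fin.last r).succAbove (Fin.succAbove 0))
      rw [Fintype.card_fin] at h1
      rw [← h1, ← Matrix.det_transpose]
      congr 1
      ext j i
      rw [Matrix.transpose_apply, Matrix.neg_apply, Matrix.submatrix_apply, Fin.succAbove_last,
        Fin.succAbove_zero, hdiff, Matrix.of_apply, Finset.sum_apply]
    rw [this, Matrix.det_sum_rows]
    refine Finset.sum_congr rfl fun b _ => ?_
    rw [← Matrix.det_transpose (Matrix.of fun i j : Fin r => rowFn C h i r (b j)),
      ← Matrix.det_mul_column]
    rfl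
  · intro j _
    simp [B, hlast]

/-- Triangular arrays of integers, without the interlacing condition. -/
abbrev TriangularArray (n : ℕ) : Type := (r : Set.Icc 1 n) → Fin r.1 → ℤ

/-- Add a top row to a triangular array. -/
def TriangularArray.extend {n : ℕ} (x : Fin (n + 1) → ℤ) (y : TriangularArray n) :
    TriangularArray (n + 1) :=
  fun r i => if h : r.1 ≤ n then y ⟨r.1, r.2.1, h⟩ i else x (Fin.castLE r.2.2 i)

lemma TriangularArray.extend_of_le {n : ℕ} (x : Fin (n + 1) → ℤ) (y : TriangularArray n)
    {r : ℕ} (h₁ : 1 ≤ r) (h₂ : r ≤ n) :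
    y.extend x ⟨r, h₁, h₂.trans n.le_succ⟩ = y ⟨r, h₁, h₂⟩ := by
  funext i
  exact dif_pos h₂

lemma TriangularArray.extend_top {n : ℕ} (x : Fin (n + 1) → ℤ) (y : TriangularArray n) :
    y.extend x ⟨n + 1, Nat.le_add_left 1 n, le_rfl⟩ = x := by
  funext i
  exact dif_neg (by simp)

lemma TriangularArray.extend_injective {n : ℕ} (x : Fin (n + 1) → ℤ) :
    Function.Injective (TriangularArray.extend x) := by
  intro y y' h
  funext ⟨r, h₁, h₂⟩
  rw [← TriangularArray.extend_of_le x y h₁ h₂, h, TriangularArray.extend_of_le x y' h₁ h₂]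

/-- The arrays underlying the patterns of depth `n` with top row `x`. -/
def patternArrays : (n : ℕ) → (Fin n → ℤ) → Finset (TriangularArray n)
  | 0, _ => {fun r => absurd (r.2.1.trans r.2.2) (by simp)}
  | n + 1, x => (interlacingRows x).biUnion fun b =>
      (patternArrays n b).map ⟨TriangularArray.extend x, TriangularArray.extend_injective x⟩

lemma mem_patternArrays_succ {n : ℕ} {x : Fin (n + 1) → ℤ} {y : TriangularArray (n + 1)} :
    y ∈ patternArrays (n + 1) x
      ↔ ∃ b, Interlaces x b ∧ ∃ y' ∈ patternArrays n b, y'.extend x = y := by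
  simp [patternArrays, mem_interlacingRows]

lemma mem_patternArrays {n : ℕ} {x : Fin n → ℤ} {y : TriangularArray n} :
    y ∈ patternArrays n x ↔ (∀ hn : 1 ≤ n, y ⟨n, hn, le_rfl⟩ = x) ∧
      ∀ (r : ℕ) (h₁ : 1 ≤ r) (h₂ : r + 1 ≤ n),
        Interlaces (y ⟨r + 1, Nat.le_add_left 1 r, h₂⟩) (y ⟨r, h₁, (Nat.le_succ r).trans h₂⟩) := by
  induction n with
  | zero =>
    refine iff_of_true ?_ ⟨fun hn => absurd hn (by simp), fun r _ h₂ => absurd h₂ (by simp)⟩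
    rw [patternArrays, Finset.mem_singleton]
    funext r
    exact absurd (r.2.1.trans r.2.2) (by simp)
  | succ n ih =>
    rw [mem_patternArrays_succ]
    constructor
    · rintro ⟨b, hb, y', hy', rfl⟩
      rw [ih] at hy'
      refine ⟨fun hn => TriangularArray.extend_top _ _, fun r h₁ h₂ => ?_⟩
      rcases Nat.lt_or_ge n (r + 1) with h | h
      · obtain rfl : r = n := by omega
        rw [TriangularArray.extend_top, TriangularArray.extend_of_le _ _ h₁ le_rfl, hy'.1 h₁]
        exact hb
      · rw [TriangularArray.extend_of_le _ _ (Nat.le_add_left 1 r) h,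
          TriangularArray.extend_of_le _ _ h₁ (by omega)]
        exact hy'.2 r h₁ h
    · rintro ⟨htop, hint⟩
      have htop := htop (Nat.le_add_left 1 n)
      refine ⟨fun i => y ⟨n, Nat.one_le_of_lt i.pos, n.le_succ⟩ i, ?_,
        fun r => y ⟨r.1, r.2.1, r.2.2.trans n.le_succ⟩, ?_, ?_⟩
      · intro i
        have := hint n (Nat.one_le_of_lt i.pos) le_rfl i
        rwa [htop] at this
      · rw [ih]
        exact ⟨fun hn => rfl, fun r h₁ h₂ => hint r h₁ (h₂.trans n.le_succ)⟩
      · funext ⟨r, h₁, h₂⟩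
        rcases Nat.lt_or_ge n r with h | h
        · obtain rfl : r = n + 1 := le_antisymm h₂ h
          rw [TriangularArray.extend_top, htop]
        · rw [TriangularArray.extend_of_le _ _ h₁ h]

lemma prod_label_extend {n : ℕ} (x : Fin (n + 1) → ℤ) (y : TriangularArray n) (h : ℕ → ℤ → ℂ) :
    ∏ p : GTLabel (n + 1), h p.1 (y.extend x p.1 p.2)
      = (∏ j, h (n + 1) (x j)) * ∏ p : GTLabel n, h p.1 (y p.1 p.2) := by
  let e : Fin (n + 1) ⊕ GTLabel n → GTLabel (n + 1) :=
    Sum.elim (fun i => ⟨⟨n + 1, Nat.le_add_left 1 n, le_rfl⟩, i⟩)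
      fun p => ⟨⟨p.1.1, p.1.2.1, p.1.2.2.trans n.le_succ⟩, p.2⟩
  have he : Function.Bijective e := by
    constructor
    · rintro (i | ⟨⟨r, h₁, h₂⟩, i⟩) (j | ⟨⟨s, h₃, h₄⟩, j⟩) hij
      · simpa [e] using hij
      · have := congrArg (fun p : GTLabel (n + 1) => p.1.1) hij
        simp [e] at this; omega
      · have := congrArg (fun p : GTLabel (n + 1) => p.1.1) hij
        simp [e] at this; omega
      · have := congrArg (fun p : GTLabel (n + 1) => p.1.1) hij
        simp only [e, Sum.elim_inr] at this
        subst this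
        simpa [e] using hij
    · rintro ⟨⟨r, h₁, h₂⟩, i⟩
      rcases Nat.lt_or_ge n r with h | h
      · obtain rfl : r = n + 1 := le_antisymm h₂ h
        exact ⟨Sum.inl i, rfl⟩
      · exact ⟨Sum.inr ⟨⟨r, h₁, h⟩, i⟩, rfl⟩
  rw [← he.prod_comp, Fintype.prod_sum_type]
  congr 1
  · refine Finset.prod_congr rfl fun i _ => ?_
    simp only [e, Sum.elim_inl]
    rw [TriangularArray.extend_top]
  · refine Finset.prod_congr rfl fun p _ => ?_
    simp only [e, Sum.elim_inr]
    rw [TriangularArray.extend_of_le _ _ p.1.2.1 p.1.2.2]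

lemma sum_patternArrays_prod (C : ℤ) (h : ℕ → ℤ → ℂ) {n : ℕ} {x : Fin n → ℤ} (hx : Antitone x)
    (hC : ∀ j, C - n ≤ x j) :
    ∑ y ∈ patternArrays n x, ∏ p : GTLabel n, h p.1 (y p.1 p.2)
      = (∏ j, h n (x j)) * (Matrix.of fun i j : Fin n => rowFn C h i n (x j)).det := by
  induction n with
  | zero =>
    rw [patternArrays, Finset.sum_singleton]
    have : IsEmpty (GTLabel 0) := ⟨fun p => absurd (p.1.2.1.trans p.1.2.2) (by simp)⟩
    simp
  | succ n ih =>
    rw [patternArrays, Finset.sum_biUnion, det_rowFn_succ C h n hx hC, Finset.mul_sum]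
    · refine Finset.sum_congr rfl fun b hb => ?_
      rw [mem_interlacingRows] at hb
      rw [← ih (hb.strictAnti hx).antitone fun j => ?_, Finset.sum_map, Finset.mul_sum]
      · exact Finset.sum_congr rfl fun y _ => prod_label_extend x y h
      · have := hb.le hC j
        push_cast at this
        linarith
    · intro b _ b' _ hbb'
      rw [Function.onFun, Finset.disjoint_left]
      intro y hy hy'
      obtain ⟨z, hz, rfl⟩ := Finset.mem_map.1 hy
      obtain ⟨z', hz', hzz⟩ := Finset.mem_map.1 hy'
      obtain rfl : z' = z := TriangularArray.extend_injective x hzz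
      apply hbb'
      rw [mem_patternArrays] at hz hz'
      -- An array determines b as its row n; for n = 0 there is no such row, but b is then unique.
      rcases Nat.eq_zero_or_pos n with rfl | hn
      · exact Subsingleton.elim _ _
      · rw [← hz.1 hn, ← hz'.1 hn]

lemma patternArrays_nonempty {n : ℕ} {x : Fin n → ℤ} (hx : StrictAnti x) :
    (patternArrays n x).Nonempty := by
  -- Row r consists of the first r entries of x.
  refine ⟨fun r i => x (Fin.castLE r.2.2 i),
    mem_patternArrays.2 ⟨fun hn => rfl, fun r h₁ h₂ i => ?_⟩⟩
  exact ⟨le_rfl, hx (by simp [Fin.lt_def])⟩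

lemma le_of_mem_patternArrays {n : ℕ} {x : Fin n → ℤ} {C : ℤ} (hC : ∀ j, C - n ≤ x j)
    {y : TriangularArray n} (hy : y ∈ patternArrays n x) (r : Set.Icc 1 n) (i : Fin r.1) :
    C - r.1 ≤ y r i := by
  induction n with
  | zero => exact absurd (r.2.1.trans r.2.2) (by simp)
  | succ n ih =>
    obtain ⟨b, hb, y', hy', rfl⟩ := mem_patternArrays_succ.1 hy
    obtain ⟨r, h₁, h₂⟩ := r
    rcases Nat.lt_or_ge n r with h | h
    · obtain rfl : r = n + 1 := le_antisymm h₂ h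
      rw [TriangularArray.extend_top]
      exact hC i
    · rw [TriangularArray.extend_of_le _ _ h₁ h]
      refine ih (fun j => ?_) hy' ⟨r, h₁, h⟩ i
      have := hb.le hC j
      push_cast at this
      linarith

lemma strictAnti_of_mem_patternArrays {n : ℕ} {x : Fin n → ℤ} (hx : StrictAnti x)
    {y : TriangularArray n} (hy : y ∈ patternArrays n x) (r : Set.Icc 1 n) : StrictAnti (y r) := by
  induction n with
  | zero => exact absurd (r.2.1.trans r.2.2) (by simp)
  | succ n ih =>
    obtain ⟨b, hb, y', hy', rfl⟩ := mem_patternArrays_succ.1 hy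
    obtain ⟨r, h₁, h₂⟩ := r
    rcases Nat.lt_or_ge n r with h | h
    · obtain rfl : r = n + 1 := le_antisymm h₂ h
      rwa [TriangularArray.extend_top]
    · rw [TriangularArray.extend_of_le _ _ h₁ h]
      exact ih (hb.strictAnti hx.antitone) hy' ⟨r, h₁, h⟩

/-! ### Fredholm determinants and correlations -/

/-- N strictly raises the level, so 1 + N is block triangular with identity diagonal blocks. -/
lemma Matrix.det_one_add_of_level {ι : Type*} [Fintype ι] [DecidableEq ι] (N : Matrix ι ι ℂ)
    (lev : ι → ℕ) (hN : ∀ a b, lev b ≤ lev a → N a b = 0) : (1 + N).det = 1 := by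
  have htri : (1 + N).BlockTriangular lev := fun a b hab => by
    rw [Matrix.add_apply, hN a b hab.le, Matrix.one_apply_ne (by rintro rfl; exact hab.false),
      add_zero]
  rw [htri.det]
  refine Finset.prod_eq_one fun l _ => ?_
  rw [show (1 + N).toSquareBlock lev l = 1 from ?_, Matrix.det_one]
  ext a b
  rw [Matrix.toSquareBlock_def, Matrix.of_apply, Matrix.add_apply,
    hN _ _ (by rw [a.2, b.2]), add_zero, Matrix.one_apply, Matrix.one_apply]
  simp [Subtype.ext_iff]

/-- A perturbation of `A` through a unipotent system, computed by evaluating a block determinant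
in two ways. -/
lemma Matrix.det_sub_mul_of_eq_sub {ι κ : Type*} [Fintype ι] [DecidableEq ι] [Fintype κ]
    [DecidableEq κ] (A : Matrix κ κ ℂ) (N : Matrix ι ι ℂ) (F : Matrix ι κ ℂ) (B : Matrix κ ι ℂ)
    (Q : Matrix κ ι ℂ) (hQ : Q = A * B - Q * N) (hN : (1 + N).det = 1) :
    (A - Q * F).det = A.det * (1 + N - F * B).det := by
  have hAB : A * B = Q * (1 + N) := by
    rw [Matrix.mul_add, Matrix.mul_one]
    nth_rewrite 1 [hQ]
    rw [sub_add_cancel]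
  -- Both factorizations avoid inverting A.
  have h1 : Matrix.fromBlocks (1 + N) F (A * B) A
      = Matrix.fromBlocks 1 0 Q 1 * Matrix.fromBlocks (1 + N) F 0 (A - Q * F) := by
    rw [Matrix.fromBlocks_multiply, hAB]
    simp
  have h2 : Matrix.fromBlocks (1 + N) F (A * B) A
      = Matrix.fromBlocks 1 0 0 A * Matrix.fromBlocks (1 + N) F B 1 := by
    rw [Matrix.fromBlocks_multiply]
    simp
  have h3 := congrArg Matrix.det (h1.symm.trans h2)
  rw [Matrix.det_mul, Matrix.det_mul, Matrix.det_fromBlocks_zero₁₂, Matrix.det_fromBlocks_zero₂₁,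
    Matrix.det_fromBlocks_zero₂₁, Matrix.det_fromBlocks_one₂₂, hN] at h3
  simpa using h3

/-- Each row is written as δ_a - (δ_a - K_a) and expanded. The next lemma expands o_a = 1 - (1 -
o_a) with the same signs, so an identity between generating functions at 0/1 vectors transfers term
by term. -/
lemma Matrix.det_eq_sum_det_one_sub {ι : Type*} [Fintype ι] [DecidableEq ι] (K : Matrix ι ι ℂ) :
    K.det = ∑ e ∈ Fintype.piFinset (fun _ : ι => Finset.range 2), (∏ a, (-1 : ℂ) ^ e a) *
      (1 - Matrix.diagonal (fun a => (e a : ℂ)) * K).det := by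
  have h := Matrix.det_sum_rows (R := ℂ) (fun _ : ι => Finset.range 2)
    (fun a e b => (-1) ^ e * ((1 : Matrix ι ι ℂ) a b - e * K a b))
  have h1 : K = Matrix.of fun a => ∑ e ∈ Finset.range 2,
      fun b => (-1 : ℂ) ^ e * ((1 : Matrix ι ι ℂ) a b - e * K a b) := by
    ext a b
    simp [Finset.sum_range_succ]
  rw [← h1] at h
  rw [h]
  refine Finset.sum_congr rfl fun e _ => ?_
  rw [← Matrix.det_mul_column]
  congr 1
  ext a b
  simp [Matrix.diagonal_mul]

lemma prod_eq_sum_prod_one_sub {ι : Type*} [Fintype ι] [DecidableEq ι] (o : ι → ℂ) :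
    ∏ a, o a = ∑ e ∈ Fintype.piFinset (fun _ : ι => Finset.range 2), (∏ a, (-1 : ℂ) ^ e a) *
      ∏ a, (1 - (e a : ℂ) * o a) := by
  have h := Finset.prod_univ_sum (fun _ : ι => Finset.range 2)
    (fun a e => (-1 : ℂ) ^ e * (1 - e * o a))
  rw [Finset.prod_congr rfl fun a _ => show o a = ∑ e ∈ Finset.range 2,
    (-1 : ℂ) ^ e * (1 - e * o a) by simp [Finset.sum_range_succ], h]
  exact Finset.sum_congr rfl fun e _ => Finset.prod_mul_distrib

/-- By injectivity each particle meets at most one marked site and conversely, so both sides are one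
double product over pairs, taken in either order. -/
lemma prod_one_sub_sum_ite {ι κ Λ : Type*} [Fintype ι] [Fintype κ] [DecidableEq Λ] {z : ι → Λ}
    {y : κ → Λ} [∀ a, Decidable (∃ p, y p = z a)]
    (hz : Function.Injective z) (hy : Function.Injective y) (t : ι → ℂ) :
    ∏ p, (1 - ∑ a, if z a = y p then t a else 0)
      = ∏ a, (1 - t a * if ∃ p, y p = z a then 1 else 0) := by
  have h1 : ∀ p, (1 - ∑ a, if z a = y p then t a else 0)
      = ∏ a, if z a = y p then 1 - t a else 1 := by
    intro p
    by_cases h : ∃ a, z a = y p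
    · classical
      obtain ⟨a, ha⟩ := h
      simp only [← ha, hz.eq_iff]
      simp
    · push Not at h
      simp [h]
  rw [Finset.prod_congr rfl fun p _ => h1 p, Finset.prod_comm]
  refine Finset.prod_congr rfl fun a _ => ?_
  by_cases h : ∃ p, y p = z a
  · classical
    rw [if_pos h]
    obtain ⟨p, hp⟩ := h
    simp only [← hp, hy.eq_iff]
    simp
  · rw [if_neg h]
    push Not at h
    simp [fun p => (h p).symm]

/-- The perturbation equation is used twice: at the marked sites it is the linear system for Q, and
at the top row it expresses the weighted matrix as A - Q · diag(t) · F. -/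
lemma weighted_count_eq_det {n : ℕ} {x : Fin n → ℤ} (hx : Function.Injective x) {C : ℤ}
    (hC : ∀ j, C - n ≤ x j) {ι : Type*} [Fintype ι] [DecidableEq ι] (lev : ι → ℕ) (pos : ι → ℤ)
    (hlev : ∀ a, lev a ≤ n) (hpos : ∀ a, C - lev a ≤ pos a) (t : ι → ℂ) :
    let h : ℕ → ℤ → ℂ := fun r u => 1 - ∑ a, if lev a = r ∧ pos a = u then t a else 0
    (∏ j, h n (x j)) * (Matrix.of fun i j : Fin n => rowFn C h i n (x j)).det
      = (Matrix.of fun i j : Fin n => rowFnOne C i n (x j)).det *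
        (1 - Matrix.diagonal t * Matrix.of fun a b => ∑ k, topFn x (pos a) (lev a) k *
          nodeFn x k (pos b) (lev b) - gtPhi (lev a) (lev b) (pos a) (pos b)).det := by
  intro h
  have hpert : ∀ i s v, rowFn C h i s v = rowFnOne C i s v
      - ∑ a, rowFn C h i (lev a) (pos a) * t a * gtPhi (lev a) s (pos a) v :=
    rowFn_perturb C t lev pos hpos
  let A : Matrix (Fin n) (Fin n) ℂ := Matrix.of fun i j => rowFnOne C i n (x j)
  let G : Matrix ι ι ℂ := Matrix.of fun a b => gtPhi (lev a) (lev b) (pos a) (pos b)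
  let F : Matrix ι (Fin n) ℂ := Matrix.of fun a k => topFn x (pos a) (lev a) k
  let B : Matrix (Fin n) ι ℂ := Matrix.of fun k b => nodeFn x k (pos b) (lev b)
  let Q : Matrix (Fin n) ι ℂ := Matrix.of fun i a => rowFn C h i (lev a) (pos a)
  have hQ : Q = A * B - Q * (Matrix.diagonal t * G) := by
    ext i b
    rw [← Matrix.mul_assoc, Matrix.sub_apply, Matrix.mul_apply, Matrix.mul_apply]
    simp only [Matrix.mul_diagonal, A, B, Q, G, Matrix.of_apply]
    rw [sum_rowFnOne_mul_nodeFn hx hC i.2 (hlev b) (hpos b)]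
    exact hpert i (lev b) (pos b)
  have hN : (1 + Matrix.diagonal t * G).det = 1 :=
    Matrix.det_one_add_of_level _ lev fun a b hab => by
      simp [Matrix.diagonal_mul, G, gtPhi_eq_zero_of_le hab]
  have key := Matrix.det_sub_mul_of_eq_sub A (Matrix.diagonal t * G) (Matrix.diagonal t * F) B Q
    hQ hN
  have hL : (A - Q * (Matrix.diagonal t * F))
      = Matrix.of fun i j => h n (x j) * (Matrix.of fun i j : Fin n => rowFn C h i n (x j)) i j := by
    ext i j
    rw [← Matrix.mul_assoc, Matrix.sub_apply, Matrix.mul_apply]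
    simp only [Matrix.mul_diagonal, A, Q, F, Matrix.of_apply]
    have h1 : h n (x j) * rowFn C h i n (x j) = rowFn C h i n (x j)
        - ∑ a, rowFn C h i (lev a) (pos a) * t a * if lev a = n ∧ pos a = x j then 1 else 0 := by
      simp only [h, sub_mul, one_mul, Finset.sum_mul]
      congr 1
      refine Finset.sum_congr rfl fun a _ => ?_
      split_ifs with ha
      · rw [ha.1, ha.2]; ring
      · ring
    rw [h1, hpert i n (x j), sub_sub, ← Finset.sum_add_distrib]
    congr 1
    refine Finset.sum_congr rfl fun a _ => ?_
    rw [← mul_add, topFn]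
    congr 1
    -- Top-row marks act through the factor h(n, x_j), lower marks through φ; exactly one of the two
    -- is active, whence the two cases of `topFn`.
    by_cases ha : lev a = n
    · simp [ha, gtPhi_eq_zero_of_le le_rfl]
    · simp [ha]
  rw [hL, Matrix.det_mul_row] at key
  rw [key]
  congr 2
  rw [show (Matrix.of fun a b => ∑ k, topFn x (pos a) (lev a) k *
          nodeFn x k (pos b) (lev b) - gtPhi (lev a) (lev b) (pos a) (pos b)) = F * B - G from ?_]
  · rw [Matrix.mul_sub, Matrix.mul_assoc]
    abel
  · ext a b
    simp [Matrix.mul_apply, F, B, G]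

/-- The correlation kernel; it vanishes at positions that particles cannot reach. -/
def gtKernel {n : ℕ} (x : Fin n → ℤ) (C : ℤ) (p q : GTPosition n) : ℂ :=
  if C - p.2.1 ≤ p.1 ∧ C - q.2.1 ≤ q.1 then
    ∑ k, topFn x p.1 p.2 k * nodeFn x k q.1 q.2 - gtPhi p.2 q.2 p.1 q.1
  else 0

/-- The configuration of particles of an array. -/
def arrayParticles {n : ℕ} (y : TriangularArray n) (p : GTLabel n) : GTPosition n :=
  (y p.1 p.2, p.1)

lemma arrayParticles_injective {n : ℕ} {x : Fin n → ℤ} (hx : StrictAnti x)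
    {y : TriangularArray n} (hy : y ∈ patternArrays n x) :
    Function.Injective (arrayParticles y) := by
  rintro ⟨r, i⟩ ⟨s, j⟩ h
  simp only [arrayParticles, Prod.mk.injEq] at h
  obtain ⟨h1, rfl⟩ := h
  rw [(strictAnti_of_mem_patternArrays hx hy r).injective h1]

open Classical in
lemma sum_prod_occupied_eq_det {n : ℕ} {x : Fin n → ℤ} (hx : StrictAnti x) {C : ℤ}
    (hC : ∀ j, C - n ≤ x j) {m : ℕ} {z : Fin m → GTPosition n} (hz : Function.Injective z) :
    ∑ y ∈ patternArrays n x, ∏ a, (if ∃ p, arrayParticles y p = z a then (1 : ℂ) else 0)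
      = (patternArrays n x).card * (Matrix.of fun a b => gtKernel x C (z a) (z b)).det := by
  by_cases hval : ∀ a, C - (z a).2.1 ≤ (z a).1
  · have hcount : ∀ t : Fin m → ℂ, ∑ y ∈ patternArrays n x,
        ∏ a, (1 - t a * if ∃ p, arrayParticles y p = z a then (1 : ℂ) else 0)
        = (Matrix.of fun i j : Fin n => rowFnOne C i n (x j)).det *
          (1 - Matrix.diagonal t * Matrix.of fun a b => gtKernel x C (z a) (z b)).det := by
      intro t
      have h1 := weighted_count_eq_det hx.injective hC (fun a => (z a).2.1) (fun a => (z a).1)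
        (fun a => (z a).2.2.2) hval t
      have h2 : (Matrix.of fun a b => gtKernel x C (z a) (z b))
          = Matrix.of fun a b => ∑ k, topFn x (z a).1 (z a).2.1 k *
          nodeFn x k (z b).1 (z b).2.1 - gtPhi (z a).2.1 (z b).2.1 (z a).1 (z b).1 := by
        ext a b
        exact if_pos ⟨hval a, hval b⟩
      rw [h2]
      refine Eq.trans ?_ ((sum_patternArrays_prod C (fun r u =>
        1 - ∑ a, if (z a).2.1 = r ∧ (z a).1 = u then t a else 0) hx.antitone hC).trans h1)
      refine Finset.sum_congr rfl fun y hy => ?_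
      rw [← prod_one_sub_sum_ite hz (arrayParticles_injective hx hy) t]
      refine Finset.prod_congr rfl fun p _ => ?_
      congr 1
      refine Finset.sum_congr rfl fun a _ => ?_
      simp only [arrayParticles, Prod.ext_iff, Subtype.ext_iff, and_comm]
    -- At t = 0 the generating function gives the normalizing constant.
    have hZ : ((patternArrays n x).card : ℂ)
        = (Matrix.of fun i j : Fin n => rowFnOne C i n (x j)).det := by
      simpa using hcount 0
    rw [hZ, Matrix.det_eq_sum_det_one_sub (Matrix.of fun a b => gtKernel x C (z a) (z b)),
      Finset.mul_sum, Finset.sum_congr rfl fun y _ => prod_eq_sum_prod_one_sub _, Finset.sum_comm]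
    refine Finset.sum_congr rfl fun e _ => ?_
    rw [← Finset.mul_sum, hcount fun a => (e a : ℂ)]
    ring
  -- An unreachable site is never occupied, and its row of the kernel is zero.
  · push Not at hval
    obtain ⟨a, ha⟩ := hval
    rw [Matrix.det_eq_zero_of_row_eq_zero a, mul_zero]
    · refine Finset.sum_eq_zero fun y hy => Finset.prod_eq_zero (Finset.mem_univ a) ?_
      rw [if_neg]
      rintro ⟨p, hp⟩
      have := le_of_mem_patternArrays hC hy p.1 p.2
      rw [← hp] at ha
      exact ha.not_ge this
    · intro b
      exact if_neg fun h => ha.not_ge h.1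

/-! ### Correlation functions of uniform measures on finite sets -/

lemma Measure.pi_count_eq_count {Λ : Type*} [MeasurableSpace Λ] [Countable Λ]
    [MeasurableSingletonClass Λ] (m : ℕ) :
    (Measure.pi fun _ : Fin m => (Measure.count : Measure Λ)) = Measure.count := by
  refine Measure.ext_of_singleton fun z => ?_
  rw [← Set.univ_pi_singleton, Measure.pi_pi, Set.univ_pi_singleton]
  simp

open Classical in
lemma tupleCount_eq_sum {Λ ι : Type*} [Fintype ι] (m : ℕ) (B : Set (Fin m → Λ)) (y : ι → Λ) :
    tupleCount m B y = ∑ f : Fin m ↪ ι, if (fun k => y (f k)) ∈ B then 1 else 0 := by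
  rw [tupleCount, Set.ncard_eq_toFinset_card', Finset.card_eq_sum_ones, Set.toFinset_ofPred,
    Finset.sum_filter]

lemma tsum_indicator_tupleCount_singleton {Λ ι : Type*} [Fintype ι] (m : ℕ)
    (B : Set (Fin m → Λ)) (y : ι → Λ) :
    ∑' z, B.indicator (fun z => (tupleCount m {z} y : ℝ≥0∞)) z = tupleCount m B y := by
  classical
  have h : ∀ z, B.indicator (fun z => (tupleCount m {z} y : ℝ≥0∞)) z
      = ∑' f : Fin m ↪ ι, if z = (fun k => y (f k)) then
        (if (fun k => y (f k)) ∈ B then 1 else 0) else 0 := by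
    intro z
    rw [tsum_fintype, Set.indicator_apply, tupleCount_eq_sum, Nat.cast_sum]
    split_ifs with hz
    · refine Finset.sum_congr rfl fun f _ => ?_
      by_cases hf : z = fun k => y (f k)
      · rw [if_pos hf, if_pos (by rw [Set.mem_singleton_iff, hf]), if_pos (hf ▸ hz), Nat.cast_one]
      · rw [if_neg hf, if_neg fun h => hf (Set.mem_singleton_iff.1 h).symm, Nat.cast_zero]
    · refine (Finset.sum_eq_zero fun f _ => ?_).symm
      by_cases hf : z = fun k => y (f k)
      · rw [if_pos hf, if_neg (hf ▸ hz)]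
      · rw [if_neg hf]
  simp only [h]
  rw [ENNReal.tsum_comm, tsum_fintype, tupleCount_eq_sum, Nat.cast_sum]
  refine Finset.sum_congr rfl fun f _ => ?_
  rw [tsum_ite_eq]
  split_ifs <;> simp

open Classical in
-- Since y is injective, at most one labelling realizes z, and none does when z repeats a position.
lemma tupleCount_singleton {Λ ι : Type*} [Fintype ι] {m : ℕ} (z : Fin m → Λ) {y : ι → Λ}
    (hy : Function.Injective y) :
    tupleCount m {z} y
      = if Function.Injective z then ∏ k, (if ∃ p, y p = z k then 1 else 0) else 0 := by
  split_ifs with hz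
  · by_cases h : ∀ k, ∃ p, y p = z k
    · rw [Finset.prod_eq_one fun k _ => if_pos (h k), tupleCount, Set.ncard_eq_one]
      choose f hf using h
      have hinj : Function.Injective f := fun a b hab => hz (by rw [← hf a, ← hf b, hab])
      refine ⟨⟨f, hinj⟩, ?_⟩
      ext g
      simp only [Set.mem_ofPred_eq, Set.mem_singleton_iff]
      constructor
      · intro hg
        ext k
        exact hy ((congrFun hg k).trans (hf k).symm)
      · rintro rfl
        exact funext hf
    · push Not at h
      obtain ⟨k, hk⟩ := h
      rw [Finset.prod_eq_zero (Finset.mem_univ k) (if_neg (by simpa using hk)), tupleCount]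
      rw [Set.ncard_eq_zero]
      refine Set.eq_empty_iff_forall_notMem.2 fun g hg => hk (g k) (congrFun hg k)
  · rw [tupleCount, Set.ncard_eq_zero]
    refine Set.eq_empty_iff_forall_notMem.2 fun g hg => hz ?_
    rw [Set.mem_ofPred_eq, Set.mem_singleton_iff] at hg
    rw [← hg]
    exact hy.comp g.injective

/-- The density with respect to counting measure is the mass of each singleton; every m-tuple of
labels lands on exactly one z, so summing over z ∈ B recovers the count in B. -/
lemma isCorrelationFunction_uniformOn {Ω Λ ι : Type*} [MeasurableSpace Ω]
    [MeasurableSingletonClass Ω] [MeasurableSpace Λ] [Countable Λ] [MeasurableSingletonClass Λ]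
    [Fintype ι] (P : Finset Ω) (X : Ω → ι → Λ) (m : ℕ) :
    IsCorrelationFunction (ProbabilityTheory.uniformOn (P : Set Ω)) X Measure.count m
      fun z => (P.card : ℝ≥0)⁻¹ * ∑ y ∈ P, (tupleCount m {z} (X y) : ℝ≥0) := by
  refine ⟨Measurable.of_discrete, fun B hB => ?_⟩
  rcases P.eq_empty_or_nonempty with rfl | hP
  · simp [ProbabilityTheory.uniformOn_empty_meas]
  have hcard : (P.card : ℝ≥0) ≠ 0 := by exact_mod_cast hP.card_pos.ne'
  rw [Measure.pi_count_eq_count, ← lintegral_indicator hB, lintegral_count,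
    ProbabilityTheory.uniformOn, ProbabilityTheory.cond, lintegral_smul_measure, lintegral_finset,
    Measure.count_apply_finset]
  have h1 : ∀ z, B.indicator (fun z => (((P.card : ℝ≥0)⁻¹ * ∑ y ∈ P,
      (tupleCount m {z} (X y) : ℝ≥0) : ℝ≥0) : ℝ≥0∞)) z
      = (P.card : ℝ≥0∞)⁻¹ * ∑ y ∈ P, B.indicator (fun z => (tupleCount m {z} (X y) : ℝ≥0∞)) z := by
    intro z
    by_cases hz : z ∈ B
    · simp only [Set.indicator_of_mem hz]
      rw [ENNReal.coe_mul, ENNReal.coe_inv hcard]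
      push_cast
      rfl
    · simp only [Set.indicator_of_notMem hz, Finset.sum_const_zero, mul_zero]
  simp only [h1]
  rw [ENNReal.tsum_mul_left, Summable.tsum_finsetSum fun _ _ => ENNReal.summable, smul_eq_mul]
  congr 1
  refine Finset.sum_congr rfl fun y _ => ?_
  rw [tsum_indicator_tupleCount_singleton, Measure.count_singleton, mul_one]

open Classical in
/-- The patterns of depth `n` with top row `x`. -/
def patterns {n : ℕ} (x : Fin n → ℤ) : Finset (GTPattern n) :=
  Finset.subtype _ (patternArrays n x)

lemma mem_patterns {n : ℕ} {x : Fin n → ℤ} {y : GTPattern n} :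
    y ∈ patterns x ↔ y.1 ∈ patternArrays n x := by
  classical
  exact Finset.mem_subtype

lemma coe_patterns {n : ℕ} (hn : 1 ≤ n) (x : Fin n → ℤ) :
    (patterns x : Set (GTPattern n)) = {y | y.1 ⟨n, hn, le_rfl⟩ = x} := by
  ext y
  rw [Finset.mem_coe, mem_patterns, mem_patternArrays, Set.mem_ofPred_eq]
  exact ⟨fun h => h.1 hn, fun h => ⟨fun _ => h, y.2⟩⟩

lemma sum_patterns {M : Type*} [AddCommMonoid M] {n : ℕ} (x : Fin n → ℤ)
    (f : TriangularArray n → M) : ∑ y ∈ patterns x, f y.1 = ∑ y ∈ patternArrays n x, f y := by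
  classical
  exact Finset.sum_subtype_of_mem f fun y hy => (mem_patternArrays.1 hy).2

lemma correlation_eq_det {n : ℕ} {x : Fin n → ℤ} (hx : StrictAnti x) {C : ℤ}
    (hC : ∀ j, C - n ≤ x j) {m : ℕ} (z : Fin m → GTPosition n) :
    ((((((patterns x).card : ℝ≥0)⁻¹ * ∑ y ∈ patterns x,
      (tupleCount m {z} (gtParticles y) : ℝ≥0) : ℝ≥0)) : ℝ) : ℂ)
      = (Matrix.of fun a b => gtKernel x C (z a) (z b)).det := by
  classical
  have hcount : ((∑ y ∈ patterns x, tupleCount m {z} (gtParticles y) : ℕ) : ℂ)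
      = ∑ y ∈ patternArrays n x, if Function.Injective z then
        ∏ a, (if ∃ p, arrayParticles y p = z a then (1 : ℂ) else 0) else 0 := by
    rw [show ∑ y ∈ patterns x, tupleCount m {z} (gtParticles y)
      = ∑ y ∈ patternArrays n x, tupleCount m {z} (arrayParticles y) from
      sum_patterns x fun y => tupleCount m {z} (arrayParticles y), Nat.cast_sum]
    refine Finset.sum_congr rfl fun y hy => ?_
    rw [tupleCount_singleton z (arrayParticles_injective hx hy)]
    push_cast
    rfl
  have hcard : (patterns x).card = (patternArrays n x).card := by
    rw [Finset.card_eq_sum_ones, Finset.card_eq_sum_ones]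
    exact sum_patterns x fun _ => 1
  have hne : ((patternArrays n x).card : ℂ) ≠ 0 := by
    exact_mod_cast (patternArrays_nonempty hx).card_pos.ne'
  rw [← Nat.cast_sum, NNReal.coe_mul, NNReal.coe_inv, NNReal.coe_natCast, NNReal.coe_natCast,
    Complex.ofReal_mul, Complex.ofReal_inv, Complex.ofReal_natCast, Complex.ofReal_natCast, hcount,
    hcard]
  by_cases hz : Function.Injective z
  · simp only [if_pos hz]
    rw [sum_prod_occupied_eq_det hx hC hz, inv_mul_cancel_left₀ hne]
  -- A repeated position gives zero probability on one side and two equal rows on the other.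
  · simp only [if_neg hz, Finset.sum_const_zero, mul_zero]
    rw [Function.Injective] at hz
    push Not at hz
    obtain ⟨a, b, hab, hne⟩ := hz
    refine (Matrix.det_zero_of_row_eq hne ?_).symm
    funext c
    simp only [Matrix.of_apply, hab]

end

theorem mainTheorem5 (n : ℕ) (hn : 1 ≤ n) (x : Fin n → ℤ) (hx : StrictAnti x) :
    (∀ᵐ y ∂(gtUniform hn x), ∀ (r : Set.Icc 1 n) (i : Fin r.1),
      x ⟨n - 1, Nat.sub_lt hn Nat.one_pos⟩ + n - (r.1 : ℤ) ≤ y.1 r i) ∧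
    ∃ K : GTPosition n → GTPosition n → ℂ,
      IsDeterminantalProcess (gtUniform hn x) gtParticles Measure.count K ∧
      ∀ (u v : ℤ) (r s : Set.Icc 1 n), r.1 < n → s.1 < n →
        x ⟨n - 1, Nat.sub_lt hn Nat.one_pos⟩ + n - (r.1 : ℤ) ≤ u →
        x ⟨n - 1, Nat.sub_lt hn Nat.one_pos⟩ + n - (s.1 : ℤ) ≤ v →
        K (u, r) (v, s) = gtKernelTilde x u r.1 v s.1 - gtPhi r.1 s.1 u v := by
  -- With this C, the lower bound for positions on level r is C - r.
  set C : ℤ := x ⟨n - 1, Nat.sub_lt hn Nat.one_pos⟩ + n with hCdef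
  have hC : ∀ j, C - n ≤ x j := fun j => by
    rw [hCdef, add_sub_cancel_right]
    exact hx.antitone (by rw [Fin.le_def]; have := j.2; simp only; omega)
  have hne : (patterns x).Nonempty := by
    obtain ⟨y, hy⟩ := patternArrays_nonempty hx
    exact ⟨⟨y, (mem_patternArrays.1 hy).2⟩, mem_patterns.2 hy⟩
  have hμ : gtUniform hn x = ProbabilityTheory.uniformOn (patterns x : Set (GTPattern n)) := by
    rw [gtUniform, coe_patterns hn]
  rw [hμ]
  refine ⟨?_, gtKernel x C, ⟨?_, Measurable.of_discrete, fun m _ => ?_⟩, ?_⟩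
  · refine Filter.mem_of_superset (ProbabilityTheory.ae_cond_mem
      (patterns x).measurableSet) fun y hy => ?_
    exact le_of_mem_patternArrays hC (mem_patterns.1 (Finset.mem_coe.1 hy))
  · exact ProbabilityTheory.isProbabilityMeasure_uniformOn (patterns x).finite_toSet hne
  · exact ⟨_, isCorrelationFunction_uniformOn (patterns x) gtParticles m,
      correlation_eq_det hx hC⟩
  · intro u v r s hr hs hu hv
    rw [gtKernel, if_pos ⟨hu, hv⟩, sum_topFn_mul_nodeFn_eq_gtKernelTilde x u v s.1 hr]
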